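/- Let $\mathbb{C}^+=\{z\in\mathbb{C}:\operatorname{Im} z>0\}$ and let $h:\mathbb{C}^+\to\mathbb{C}$ be the Herglotz function $$h(z)=b_1z+c+\int_{\mathbb{R}}\Big(\frac{1}{\xi-z}-\frac{\xi}{1+\xi^2}\Big)\,d\beta(\xi),$$ where $b_1\ge 0$, $c\in\mathbb{R}$ and $\beta$ is a positive Borel measure on $\mathbb{R}$ with $\int_{\mathbb{R}}\frac{d\beta(\xi)}{1+\xi^2}<\infty$. Let $\Omega\subset\mathbb{R}$ be a finite union of closed and bounded intervals, let $\mathcal{O}\subset\mathbb{R}$ be a neighbourhood of $\Omega$ (that is, $\Omega\subset\operatorname{int}\mathcal{O}$), and let $0<\alpha<1$. Suppose that on the closure $\overline{\mathcal{O}}$ the measure $\beta$ is absolutely continuous with respect to Lebesgue measure, with a density $\beta_2'\ge 0$ that is $\alpha$-Hölder continuous on $\overline{\mathcal{O}}$, i.e. $|\beta_2'(x)-\beta_2'(y)|\le C|x-y|^\alpha$ for all $x,y\in\overline{\mathcal{O}}$, for some constant $C$. Then $h$ has an extension, again denoted $h$, to $\mathbb{C}^+\cup\Omega$ that is locally Hölder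 continuous with exponent $\alpha$ in the following sense: for every compact set $K\subset\mathbb{C}^+\cup\operatorname{int}\mathcal{O}$ there is a constant $C_K$ with $|h(z)-h(w)|\le C_K|z-w|^\alpha$ for all $z,w\in K\cap(\mathbb{C}^+\cup\Omega)$; in particular this holds on $\{z\in\mathbb{C}^+\cup\Omega:\operatorname{dist}(z,\Omega)\le\delta\}$ for all sufficiently small $\delta>0$ (if $\Omega\neq\emptyset$). Its boundary values are $$h(x)=b_1x+c+\mathrm{p.v.}\!\int_{\mathbb{R}}\Big(\frac{1}{\xi-x}-\frac{\xi}{1+\xi^2}\Big)\,d\beta(\xi)+i\pi\beta_2'(x),\qquad x\in\Omega,$$ where the Cauchy principal value $\mathrm{p.v.}\!\int_{\mathbb{R}}=\lim_{\varepsilon\to0+}\int_{|\xi-x|>\varepsilon}$ exists for every $x\in\Omega$. -/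

import Mathlib

open MeasureTheory Set Filter Topology
open scoped NNReal ENNReal

noncomputable section

/-- `h` is, on the open upper half-plane, the Herglotz function
`h z = b₁ z + c + ∫ (1 / (ξ - z) - ξ / (1 + ξ²)) dβ(ξ)` with `b₁ ≥ 0`, `c` real and `β` a positive
Borel measure on the line with `∫ dβ(ξ) / (1 + ξ²) < ∞`.  The values of `h` off the open upper
half-plane are irrelevant. -/
structure IsHerglotzWith (h : ℂ → ℂ) (b₁ c : ℝ) (β : Measure ℝ) : Prop where
  b₁_nonneg : 0 ≤ b₁
  integrable : Integrable (fun ξ : ℝ => 1 / (1 + ξ ^ 2)) β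
  eq_integral : ∀ z : ℂ, 0 < z.im →
    h z = b₁ * z + c + ∫ ξ : ℝ, (1 / ((ξ : ℂ) - z) - (ξ : ℂ) / (1 + (ξ : ℂ) ^ 2)) ∂β

/-- `Ω` is a finite union of closed and bounded intervals. -/
def IsFiniteUnionIcc (Ω : Set ℝ) : Prop :=
  ∃ (n : ℕ) (a b : Fin n → ℝ), (∀ i, a i ≤ b i) ∧ Ω = ⋃ i, Icc (a i) (b i)

/-- On the set `S` the measure `β` is absolutely continuous with respect to Lebesgue measure, with
the nonnegative density `f`. -/
def HasDensityOn (β : Measure ℝ) (f : ℝ → ℝ) (S : Set ℝ) : Prop :=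
  (∀ x ∈ S, 0 ≤ f x) ∧
    β.restrict S = (volume.restrict S).withDensity (fun x => ENNReal.ofReal (f x))

/-- The Cauchy principal value at `x` of `∫ g dβ` exists and equals `I`: the function `g` is
integrable off every `ε`-neighbourhood of `x`, and the truncated integrals converge to `I`. -/
def HasCauchyPV (g : ℝ → ℝ) (β : Measure ℝ) (x I : ℝ) : Prop :=
  (∀ ε : ℝ, 0 < ε → IntegrableOn g {ξ : ℝ | ε < |ξ - x|} β) ∧
    Tendsto (fun ε : ℝ => ∫ ξ in {ξ : ℝ | ε < |ξ - x|}, g ξ ∂β) (𝓝[>] 0) (𝓝 I)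

/-- The union of the open upper half-plane and the set `S` of the real line. -/
def upperUnion (S : Set ℝ) : Set ℂ :=
  {z : ℂ | 0 < z.im} ∪ (fun x : ℝ => (x : ℂ)) '' S

end

/-!
Near an interior point `x₀` of `O`, differentiation under the integral gives
`h' z = b₁ + ∫ (ξ - z)⁻² dβ(ξ)`. The part of `β` far from `x₀` contributes a bounded term. On an
interval around `x₀` the density `f` is replaced by `f - f (Re z)`: the subtracted term is integrated
explicitly and is bounded, and Hölder continuity bounds the rest by
`C ∫ |ξ - Re z| ^ α / |ξ - z| ^ 2 dξ`, which by scaling is a constant times `(Im z) ^ (α - 1)`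
(`IsHerglotzWith.exists_norm_deriv_le`). The Hardy–Littlewood argument
(`norm_sub_le_of_deriv_growth`) turns this growth of the derivative into an `α`-Hölder estimate on a
half-box above `x₀`.

The boundary value at a point `x` is found by the same subtraction, now along the vertical line
through `x`. The regularized integrand `(f ξ - f x) / (ξ - z)` is dominated by
`C |ξ - x| ^ (α - 1)`, so both the vertical limit and the limit of the symmetric truncations equal
the absolutely convergent integral at `z = x`. The subtracted term `f x / (ξ - z)` contributes
`iπ f x` to the vertical limit and nothing to the principal value
(`IsHerglotzWith.exists_hasCauchyPV`).

Extending `h` by these boundary values preserves the estimate on the half-box, by translating upwards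
and letting the translation tend to zero. Inside the half-plane `h` is analytic, hence locally
Lipschitz, and `IsCompact.exists_holderOnWith` passes from local estimates to one on a compact set.
-/

/-! ### Hölder continuity: metric form and compactness -/

theorem holderOnWith_of_dist_le {X Y : Type*} [PseudoMetricSpace X] [PseudoMetricSpace Y]
    {C : ℝ} {r : ℝ≥0} {f : X → Y} {s : Set X}
    (h : ∀ x ∈ s, ∀ y ∈ s, dist (f x) (f y) ≤ C * dist x y ^ (r : ℝ)) :
    HolderOnWith C.toNNReal r f s := by
  intro x hx y hy
  have h1 : nndist (f x) (f y) ≤ C.toNNReal * nndist x y ^ (r : ℝ) := by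
    rw [← NNReal.coe_le_coe]
    push_cast
    refine (h x hx y hy).trans ?_
    gcongr
    exact Real.le_coe_toNNReal C
  rw [edist_nndist, edist_nndist, ← ENNReal.coe_rpow_of_nonneg _ r.coe_nonneg]
  exact_mod_cast h1

/-- A function which is Hölder continuous near each point of a compact set is Hölder continuous on
that set: on pairs of nearby points by assumption, on pairs of distant points by boundedness. -/
theorem IsCompact.exists_holderOnWith {X Y : Type*} [MetricSpace X] [PseudoMetricSpace Y]
    {r : ℝ≥0} {f : X → Y} {K S : Set X} (hK : IsCompact K)
    (h : ∀ x ∈ K, ∃ U ∈ 𝓝 x, ∃ C : ℝ≥0, HolderOnWith C r f (U ∩ S)) :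
    ∃ C : ℝ≥0, HolderOnWith C r f (K ∩ S) := by
  have bdd : ∀ x ∈ K, ∃ U ∈ 𝓝 x, Bornology.IsBounded (f '' (U ∩ S)) := by
    intro x hx
    obtain ⟨U, hU, C, hC⟩ := h x hx
    refine ⟨U ∩ Metric.ball x 1, inter_mem hU (Metric.ball_mem_nhds x one_pos), ?_⟩
    rw [Metric.isBounded_iff]
    refine ⟨C * 2 ^ (r : ℝ), ?_⟩
    rintro _ ⟨a, ⟨⟨haU, hax⟩, haS⟩, rfl⟩ _ ⟨b, ⟨⟨hbU, hbx⟩, hbS⟩, rfl⟩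
    refine hC.dist_le_of_le ⟨haU, haS⟩ ⟨hbU, hbS⟩ ?_
    have := dist_triangle_right a b x
    rw [Metric.mem_ball] at hax hbx
    linarith
  have key : ∃ C : ℝ, 0 ≤ C ∧ ∀ p ∈ K ×ˢ K, p.1 ∈ S → p.2 ∈ S →
      dist (f p.1) (f p.2) ≤ C * dist p.1 p.2 ^ (r : ℝ) := by
    refine (hK.prod hK).induction_on (p := fun W : Set (X × X) => ∃ C : ℝ, 0 ≤ C ∧ ∀ p ∈ W,
      p.1 ∈ S → p.2 ∈ S → dist (f p.1) (f p.2) ≤ C * dist p.1 p.2 ^ (r : ℝ)) ?_ ?_ ?_ ?_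
    · exact ⟨0, le_rfl, by simp⟩
    · rintro s t hst ⟨C, hC0, hC⟩
      exact ⟨C, hC0, fun p hp => hC p (hst hp)⟩
    · rintro s t ⟨C, hC0, hC⟩ ⟨D, hD0, hD⟩
      refine ⟨max C D, le_max_of_le_left hC0, ?_⟩
      rintro p (hp | hp) h1 h2
      · exact (hC p hp h1 h2).trans (by gcongr; exact le_max_left _ _)
      · exact (hD p hp h1 h2).trans (by gcongr; exact le_max_right _ _)
    · rintro ⟨x, y⟩ ⟨hx, hy⟩
      simp only at hx hy
      by_cases hxy : x = y
      · subst hxy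
        obtain ⟨U, hU, C, hC⟩ := h x hx
        exact ⟨U ×ˢ U, mem_nhdsWithin_of_mem_nhds (prod_mem_nhds hU hU), C, C.2,
          fun p hp h1 h2 => hC.dist_le ⟨hp.1, h1⟩ ⟨hp.2, h2⟩⟩
      · obtain ⟨U, hU, hUb⟩ := bdd x hx
        obtain ⟨V, hV, hVb⟩ := bdd y hy
        obtain ⟨D, hD⟩ := Metric.isBounded_iff.1 (hUb.union hVb)
        have hd : 0 < dist x y := dist_pos.2 hxy
        have hev : ∀ᶠ p : X × X in 𝓝 (x, y), dist x y / 2 < dist p.1 p.2 :=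
          (continuous_dist.tendsto (x, y)).eventually_const_lt (half_lt_self hd)
        have hpow : 0 < (dist x y / 2) ^ (r : ℝ) := by positivity
        refine ⟨(U ×ˢ V) ∩ {p | dist x y / 2 < dist p.1 p.2},
          mem_nhdsWithin_of_mem_nhds (inter_mem (prod_mem_nhds hU hV) hev),
          max D 0 / (dist x y / 2) ^ (r : ℝ), by positivity, ?_⟩
        rintro p ⟨⟨hp1, hp2⟩, hp⟩ h1 h2
        have hle : dist (f p.1) (f p.2) ≤ max D 0 :=
          (hD (Or.inl ⟨p.1, ⟨hp1, h1⟩, rfl⟩) (Or.inr ⟨p.2, ⟨hp2, h2⟩, rfl⟩)).trans (le_max_left _ _)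
        refine hle.trans ?_
        rw [div_mul_eq_mul_div, le_div_iff₀ hpow]
        gcongr
        exact le_of_lt hp
  obtain ⟨C, -, hC⟩ := key
  exact ⟨C.toNNReal, holderOnWith_of_dist_le
    fun x hx y hy => hC (x, y) ⟨hx.1, hy.1⟩ hx.2 hy.2⟩

/-! ### Hölder continuity from a growth bound on the derivative -/

/-- The bound `‖g'‖ ≤ M y ^ (a - 1)` integrates along a vertical segment of length `d`
to `M d ^ a / a`. -/
theorem norm_sub_vertical_le {g : ℂ → ℂ} {z : ℂ} {a M d : ℝ} (ha₀ : 0 < a) (ha₁ : a < 1)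
    (hM : 0 ≤ M) (hz : 0 < z.im) (hd : 0 ≤ d) (hg : ∀ w : ℂ, 0 < w.im → DifferentiableAt ℂ g w)
    (hb : ∀ t ∈ Ico 0 d, ‖deriv g (z + t * Complex.I)‖ ≤ M * (z.im + t) ^ (a - 1)) :
    ‖g (z + d * Complex.I) - g z‖ ≤ M / a * d ^ a := by
  have him : ∀ t : ℝ, (z + t * Complex.I).im = z.im + t := fun t => by simp
  have hder : ∀ t ∈ Icc 0 d, HasDerivAt (fun t : ℝ => g (z + t * Complex.I) - g z)
      (deriv g (z + t * Complex.I) * Complex.I) t := by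
    intro t ht
    have h1 : HasDerivAt (fun t : ℝ => z + t * Complex.I) Complex.I t := by
      simpa using ((Complex.ofRealCLM.hasDerivAt (x := t)).mul_const Complex.I).const_add z
    have h2 := (hg (z + t * Complex.I) (by rw [him]; linarith [ht.1])).hasDerivAt
    exact (h2.comp_of_eq t h1 rfl).sub_const _
  have hB : ∀ t ∈ Icc 0 d, HasDerivAt (fun t : ℝ => M / a * ((z.im + t) ^ a - z.im ^ a))
      (M * (z.im + t) ^ (a - 1)) t := by
    intro t ht
    have h1 : HasDerivAt (fun t : ℝ => z.im + t) 1 t := (hasDerivAt_id t).const_add _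
    have h2 := ((h1.rpow_const (p := a) (Or.inl (by linarith [ht.1]))).sub_const
      (z.im ^ a)).const_mul (M / a)
    rwa [one_mul, ← mul_assoc, div_mul_cancel₀ _ ha₀.ne'] at h2
  have key := image_norm_le_of_norm_deriv_right_le_deriv_boundary'
    (fun t ht => (hder t ht).continuousAt.continuousWithinAt)
    (fun t ht => (hder t (Ico_subset_Icc_self ht)).hasDerivWithinAt)
    (by simp)
    (fun t ht => (hB t ht).continuousAt.continuousWithinAt)
    (fun t ht => (hB t (Ico_subset_Icc_self ht)).hasDerivWithinAt)
    (fun t ht => by simpa using hb t ht) (right_mem_Icc.2 hd)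
  refine key.trans ?_
  have := Real.rpow_add_le_add_rpow hz.le hd ha₀.le ha₁.le
  gcongr
  linarith

/-- Hardy–Littlewood: two points at distance `d` are compared along the path which goes up by `d`,
across, and down again. -/
theorem norm_sub_le_of_deriv_growth {g : ℂ → ℂ} {x₀ r a M : ℝ} (ha₀ : 0 < a) (ha₁ : a < 1)
    (hM : 0 ≤ M) (hg : ∀ w : ℂ, 0 < w.im → DifferentiableAt ℂ g w)
    (hb : ∀ w : ℂ, |w.re - x₀| < r → 0 < w.im → w.im < 4 * r →
      ‖deriv g w‖ ≤ M * w.im ^ (a - 1))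
    {z w : ℂ} (hz : |z.re - x₀| < r) (hw : |w.re - x₀| < r) (hz₀ : 0 < z.im) (hw₀ : 0 < w.im)
    (hz₁ : z.im < r) (hw₁ : w.im < r) :
    ‖g z - g w‖ ≤ (2 * (M / a) + M) * ‖z - w‖ ^ a := by
  rcases eq_or_ne z w with rfl | hne
  · simp [Real.zero_rpow ha₀.ne']
  set d := ‖z - w‖ with hd
  have hd0 : 0 < d := norm_pos_iff.2 (sub_ne_zero.2 hne)
  -- Since `d < 3 * r`, the raised points stay below the height `4 * r`.
  have hd3 : d < 3 * r := by
    have h1 := Complex.norm_le_abs_re_add_abs_im (z - w)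
    rw [Complex.sub_re, Complex.sub_im] at h1
    rw [abs_lt] at hz hw
    have h2 : |z.re - w.re| < 2 * r := by rw [abs_lt]; constructor <;> linarith
    have h3 : |z.im - w.im| < r := by rw [abs_lt]; constructor <;> linarith
    linarith
  have vert : ∀ u : ℂ, |u.re - x₀| < r → 0 < u.im → u.im < r →
      ‖g (u + d * Complex.I) - g u‖ ≤ M / a * d ^ a := by
    intro u h1 h2 h3
    refine norm_sub_vertical_le ha₀ ha₁ hM h2 hd0.le hg fun t ht => ?_
    have := hb (u + t * Complex.I) (by simpa using h1) (by simp; linarith [ht.1])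
      (by simp; linarith [ht.2])
    simpa using this
  have horiz : ‖g (z + d * Complex.I) - g (w + d * Complex.I)‖ ≤ M * d ^ a := by
    have hconv : Convex ℝ ({u : ℂ | x₀ - r < u.re} ∩ {u : ℂ | u.re < x₀ + r} ∩
        ({u : ℂ | d < u.im} ∩ {u : ℂ | u.im < 4 * r})) :=
      ((convex_halfSpace_re_gt _).inter (convex_halfSpace_re_lt _)).inter
        ((convex_halfSpace_im_gt _).inter (convex_halfSpace_im_lt _))
    rw [abs_lt] at hz hw
    have := hconv.norm_image_sub_le_of_norm_deriv_le (𝕜 := ℂ) (f := g) (C := M * d ^ (a - 1))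
      (x := w + d * Complex.I) (y := z + d * Complex.I)
      (fun u hu => hg u (hd0.trans hu.2.1))
      (fun u hu => by
        refine (hb u ?_ (hd0.trans hu.2.1) hu.2.2).trans ?_
        · have h1 := hu.1.1
          have h2 := hu.1.2
          simp only [mem_ofPred_eq] at h1 h2
          rw [abs_lt]; constructor <;> linarith
        · exact mul_le_mul_of_nonneg_left
            (Real.rpow_le_rpow_of_nonpos hd0 (le_of_lt hu.2.1) (by linarith)) hM)
      (by simp; refine ⟨⟨?_, ?_⟩, ?_, ?_⟩ <;> linarith)
      (by simp; refine ⟨⟨?_, ?_⟩, ?_, ?_⟩ <;> linarith)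
    refine this.trans (le_of_eq ?_)
    rw [add_sub_add_right_eq_sub, ← hd, mul_assoc, ← Real.rpow_add_one hd0.ne', sub_add_cancel]
  have e : g z - g w = -(g (z + d * Complex.I) - g z) +
      (g (z + d * Complex.I) - g (w + d * Complex.I)) + (g (w + d * Complex.I) - g w) := by ring
  rw [e]
  refine (norm_add₃_le).trans ?_
  rw [norm_neg]
  linarith [vert z hz hz₀ hz₁, vert w hw hw₀ hw₁]

/-! ### The Herglotz kernel -/

/-- The kernel `1 / (ξ - z) - ξ / (1 + ξ²)` of the Herglotz representation. -/
noncomputable def herglotzKernel (z : ℂ) (ξ : ℝ) : ℂ :=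
  1 / ((ξ : ℂ) - z) - (ξ : ℂ) / (1 + (ξ : ℂ) ^ 2)

theorem one_add_sq_ne_zero (ξ : ℝ) : 1 + (ξ : ℂ) ^ 2 ≠ 0 := by
  norm_cast
  positivity

/-- At distance at least `η` from `z`, the weight `1 / (1 + ξ²)` of the Herglotz condition controls
`1 / |ξ - z|²`, uniformly for `z` in a bounded set. -/
theorem one_add_sq_le_mul_norm_sub_sq {z : ℂ} {ξ η R : ℝ} (hη : 0 < η) (h : η ≤ ‖(ξ : ℂ) - z‖)
    (hR : ‖z‖ ≤ R) : 1 + ξ ^ 2 ≤ (2 + (1 + 2 * R ^ 2) / η ^ 2) * ‖(ξ : ℂ) - z‖ ^ 2 := by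
  have h1 : |ξ| ≤ ‖(ξ : ℂ) - z‖ + R := by
    have := norm_sub_norm_le (ξ : ℂ) z
    rw [Complex.norm_real, Real.norm_eq_abs] at this
    linarith
  set n := ‖(ξ : ℂ) - z‖
  have hR0 : 0 ≤ R := (norm_nonneg z).trans hR
  have h2 : ξ ^ 2 ≤ 2 * n ^ 2 + 2 * R ^ 2 := by
    rw [← sq_abs]
    nlinarith [abs_nonneg ξ, sq_nonneg (n - R)]
  have h3 : 1 ≤ n ^ 2 / η ^ 2 := by
    rw [one_le_div (by positivity)]
    gcongr
  have h4 : (1 + 2 * R ^ 2) * 1 ≤ (1 + 2 * R ^ 2) * (n ^ 2 / η ^ 2) := by gcongr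
  calc 1 + ξ ^ 2 ≤ 2 * n ^ 2 + (1 + 2 * R ^ 2) * (n ^ 2 / η ^ 2) := by linarith
    _ = _ := by ring

theorem norm_one_div_sub_sq_le {z : ℂ} {ξ η R : ℝ} (hη : 0 < η) (h : η ≤ ‖(ξ : ℂ) - z‖)
    (hR : ‖z‖ ≤ R) :
    ‖1 / ((ξ : ℂ) - z) ^ 2‖ ≤ (2 + (1 + 2 * R ^ 2) / η ^ 2) * (1 / (1 + ξ ^ 2)) := by
  have hn : 0 < ‖(ξ : ℂ) - z‖ := hη.trans_le h
  rw [norm_div, norm_one, norm_pow, mul_one_div, div_le_div_iff₀ (by positivity) (by positivity),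
    one_mul]
  exact one_add_sq_le_mul_norm_sub_sq hη h hR

theorem norm_herglotzKernel_le {z : ℂ} {ξ η R : ℝ} (hη : 0 < η) (h : η ≤ ‖(ξ : ℂ) - z‖)
    (hR : ‖z‖ ≤ R) :
    ‖herglotzKernel z ξ‖ ≤ (R + (1 + R ^ 2) / η) * (1 / (1 + ξ ^ 2)) := by
  have hn : 0 < ‖(ξ : ℂ) - z‖ := hη.trans_le h
  have hne : (ξ : ℂ) - z ≠ 0 := norm_pos_iff.1 hn
  have e : herglotzKernel z ξ = (z + (1 + z ^ 2) / (ξ - z)) * (1 / (1 + (ξ : ℂ) ^ 2)) := by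
    have := one_add_sq_ne_zero ξ
    rw [herglotzKernel]
    field_simp
    ring
  have e2 : ‖(1 : ℂ) / (1 + (ξ : ℂ) ^ 2)‖ = 1 / (1 + ξ ^ 2) := by
    have : (1 : ℂ) / (1 + (ξ : ℂ) ^ 2) = ((1 / (1 + ξ ^ 2) : ℝ) : ℂ) := by push_cast; rfl
    rw [this, Complex.norm_real, Real.norm_of_nonneg (by positivity)]
  rw [e, norm_mul, e2]
  gcongr
  refine (norm_add_le _ _).trans ?_
  rw [norm_div]
  gcongr
  refine (norm_add_le _ _).trans ?_
  rw [norm_one, norm_pow]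
  gcongr

theorem measurable_herglotzKernel (z : ℂ) : Measurable (herglotzKernel z) := by
  unfold herglotzKernel
  fun_prop

theorem im_le_norm_ofReal_sub (z : ℂ) (ξ : ℝ) : z.im ≤ ‖(ξ : ℂ) - z‖ := by
  have := Complex.abs_im_le_norm ((ξ : ℂ) - z)
  simp only [Complex.sub_im, Complex.ofReal_im, zero_sub, abs_neg] at this
  exact (le_abs_self _).trans this

theorem abs_sub_re_le_norm_ofReal_sub (z : ℂ) (ξ : ℝ) : |ξ - z.re| ≤ ‖(ξ : ℂ) - z‖ := by
  simpa using Complex.abs_re_le_norm ((ξ : ℂ) - z)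

variable {β : Measure ℝ}

theorem integrableOn_herglotzKernel (hβ : Integrable (fun ξ : ℝ => 1 / (1 + ξ ^ 2)) β)
    {z : ℂ} {η : ℝ} (hη : 0 < η) {s : Set ℝ} (hs : MeasurableSet s)
    (h : ∀ ξ ∈ s, η ≤ ‖(ξ : ℂ) - z‖) : IntegrableOn (herglotzKernel z) s β := by
  refine ((hβ.const_mul (‖z‖ + (1 + ‖z‖ ^ 2) / η)).integrableOn (s := s)).mono'
    (measurable_herglotzKernel z).aestronglyMeasurable ?_
  filter_upwards [ae_restrict_mem hs] with ξ hξ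
  exact norm_herglotzKernel_le hη (h ξ hξ) le_rfl

theorem integrable_herglotzKernel (hβ : Integrable (fun ξ : ℝ => 1 / (1 + ξ ^ 2)) β)
    {z : ℂ} (hz : 0 < z.im) : Integrable (herglotzKernel z) β := by
  rw [← integrableOn_univ]
  exact integrableOn_herglotzKernel hβ hz MeasurableSet.univ fun ξ _ => im_le_norm_ofReal_sub z ξ

theorem hasDerivAt_herglotzKernel {z : ℂ} {ξ : ℝ} (h : (ξ : ℂ) - z ≠ 0) :
    HasDerivAt (fun z => herglotzKernel z ξ) (1 / ((ξ : ℂ) - z) ^ 2) z := by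
  have h1 : HasDerivAt (fun z : ℂ => (ξ : ℂ) - z) (-1) z := (hasDerivAt_id z).const_sub _
  have h2 := (h1.inv h).sub_const ((ξ : ℂ) / (1 + (ξ : ℂ) ^ 2))
  simpa [herglotzKernel, one_div] using h2

theorem hasDerivAt_integral_herglotzKernel (hβ : Integrable (fun ξ : ℝ => 1 / (1 + ξ ^ 2)) β)
    {z : ℂ} (hz : 0 < z.im) :
    Integrable (fun ξ : ℝ => 1 / ((ξ : ℂ) - z) ^ 2) β ∧
    HasDerivAt (fun z => ∫ ξ, herglotzKernel z ξ ∂β) (∫ ξ : ℝ, 1 / ((ξ : ℂ) - z) ^ 2 ∂β) z := by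
  have hball : ∀ w ∈ Metric.ball z (z.im / 2), z.im / 2 < w.im ∧ ‖w‖ ≤ ‖z‖ + z.im / 2 := by
    intro w hw
    rw [Metric.mem_ball, dist_eq_norm] at hw
    have h1 := Complex.abs_im_le_norm (w - z)
    rw [Complex.sub_im, abs_le] at h1
    refine ⟨by linarith [h1.1], ?_⟩
    have := norm_le_norm_add_norm_sub' w z
    linarith
  refine hasDerivAt_integral_of_dominated_loc_of_deriv_le
    (bound := fun ξ => (2 + (1 + 2 * (‖z‖ + z.im / 2) ^ 2) / (z.im / 2) ^ 2) * (1 / (1 + ξ ^ 2)))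
    (Metric.ball_mem_nhds z (half_pos hz))
    (Eventually.of_forall fun w => (measurable_herglotzKernel w).aestronglyMeasurable)
    (integrable_herglotzKernel hβ hz)
    (Measurable.aestronglyMeasurable (by fun_prop))
    (Eventually.of_forall fun ξ w hw => ?_)
    (hβ.const_mul _)
    (Eventually.of_forall fun ξ w hw => hasDerivAt_herglotzKernel ?_)
  · exact norm_one_div_sub_sq_le (half_pos hz)
      ((hball w hw).1.le.trans (im_le_norm_ofReal_sub w ξ)) (hball w hw).2
  · exact norm_pos_iff.1 (((half_pos hz).trans (hball w hw).1).trans_le (im_le_norm_ofReal_sub w ξ))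

theorem IsHerglotzWith.hasDerivAt {h : ℂ → ℂ} {b₁ c : ℝ} (hh : IsHerglotzWith h b₁ c β)
    {z : ℂ} (hz : 0 < z.im) :
    HasDerivAt h (b₁ + ∫ ξ : ℝ, 1 / ((ξ : ℂ) - z) ^ 2 ∂β) z := by
  have h1 : HasDerivAt (fun z : ℂ => (b₁ : ℂ) * z + c) b₁ z := by
    simpa using ((hasDerivAt_id z).const_mul (b₁ : ℂ)).add_const (c : ℂ)
  refine (h1.add (hasDerivAt_integral_herglotzKernel hh.integrable hz).2).congr_of_eventuallyEq ?_
  filter_upwards [(isOpen_lt continuous_const Complex.continuous_im).mem_nhds hz] with w hw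
  exact hh.eq_integral w hw

/-! ### The part of the measure with a Hölder continuous density -/

/-- No integrability is needed: both integrals are defined, or zero, together. -/
theorem HasDensityOn.setIntegral_eq {E : Type*} [NormedAddCommGroup E] [NormedSpace ℝ E]
    {f : ℝ → ℝ} {S T : Set ℝ} (hd : HasDensityOn β f S) (hf : ContinuousOn f S) (hTS : T ⊆ S)
    (hT : MeasurableSet T) (g : ℝ → E) : ∫ ξ in T, g ξ ∂β = ∫ ξ in T, f ξ • g ξ := by
  have h1 : β.restrict T = (volume.restrict T).withDensity fun x => ENNReal.ofReal (f x) := by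
    rw [← Measure.restrict_restrict_of_subset hTS, hd.2, restrict_withDensity hT,
      Measure.restrict_restrict_of_subset hTS]
  rw [h1, integral_withDensity_eq_integral_toReal_smul₀
    ((hf.mono hTS).aemeasurable hT).ennreal_ofReal (by simp)]
  refine setIntegral_congr_fun hT fun ξ hξ => ?_
  simp only [ENNReal.toReal_ofReal (hd.1 ξ (hTS hξ))]

theorem integrable_abs_rpow_div_one_add_sq {a : ℝ} (ha₀ : 0 < a) (ha₁ : a < 1) :
    Integrable fun t : ℝ => |t| ^ a / (1 + t ^ 2) := by
  have h1 := integrable_rpow_neg_one_add_norm_sq (E := ℝ) (μ := volume) (r := 2 - a)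
    (by simp; linarith)
  refine h1.mono' (Measurable.aestronglyMeasurable (by fun_prop)) (Eventually.of_forall fun t => ?_)
  have hpos : 0 < 1 + t ^ 2 := by positivity
  have h2 : |t| ^ a ≤ (1 + t ^ 2) ^ (a / 2) := by
    have : |t| ^ a = (t ^ 2) ^ (a / 2) := by
      rw [← sq_abs, ← Real.rpow_natCast, ← Real.rpow_mul (abs_nonneg t)]
      congr 1
      push_cast
      ring
    rw [this]
    gcongr
    linarith
  rw [Real.norm_of_nonneg (by positivity), Real.norm_eq_abs, sq_abs,
    show -(2 - a) / 2 = a / 2 - 1 by ring, Real.rpow_sub_one hpos.ne']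
  gcongr

/-- Scaling by `y` gives the growth rate `y ^ (a - 1)`. -/
theorem integral_abs_rpow_div_sq_add_sq {a x y : ℝ} (ha₀ : 0 < a) (ha₁ : a < 1) (hy : 0 < y) :
    Integrable (fun ξ : ℝ => |ξ - x| ^ a / ((ξ - x) ^ 2 + y ^ 2)) ∧
    ∫ ξ : ℝ, |ξ - x| ^ a / ((ξ - x) ^ 2 + y ^ 2) =
      y ^ (a - 1) * ∫ t : ℝ, |t| ^ a / (1 + t ^ 2) := by
  have e : (fun ξ : ℝ => |ξ - x| ^ a / ((ξ - x) ^ 2 + y ^ 2)) =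
      fun ξ => (fun t : ℝ => y ^ (a - 2) * (|t / y| ^ a / (1 + (t / y) ^ 2))) (ξ - x) := by
    funext ξ
    have h1 : y ^ a = y ^ (a - 2) * y ^ 2 := by
      rw [← Real.rpow_natCast, ← Real.rpow_add hy]
      norm_num
    have h2 : 0 < y ^ (a - 2) := by positivity
    simp only [abs_div, abs_of_pos hy, Real.div_rpow (abs_nonneg _) hy.le, h1]
    field_simp
    ring
  constructor
  · rw [e]
    exact (((integrable_abs_rpow_div_one_add_sq ha₀ ha₁).comp_div hy.ne').const_mul _).comp_sub_right x
  · rw [e, integral_sub_right_eq_self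
      (fun t : ℝ => y ^ (a - 2) * (|t / y| ^ a / (1 + (t / y) ^ 2))) x, integral_const_mul,
      Measure.integral_comp_div (fun t : ℝ => |t| ^ a / (1 + t ^ 2)) y, abs_of_pos hy, smul_eq_mul,
      ← mul_assoc, ← Real.rpow_add_one hy.ne']
    congr 2
    ring

theorem norm_one_div_ofReal_sub_sq (z : ℂ) (ξ : ℝ) :
    ‖1 / ((ξ : ℂ) - z) ^ 2‖ = 1 / ((ξ - z.re) ^ 2 + z.im ^ 2) := by
  rw [norm_div, norm_one, norm_pow, ← Complex.normSq_eq_norm_sq, Complex.normSq_apply]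
  simp
  ring

theorem ofReal_sub_ne_zero {z : ℂ} (hz : 0 < z.im) (ξ : ℝ) : (ξ : ℂ) - z ≠ 0 :=
  norm_pos_iff.1 (hz.trans_le (im_le_norm_ofReal_sub z ξ))

theorem integral_one_div_sub_sq {z : ℂ} (hz : 0 < z.im) (a b : ℝ) :
    ∫ ξ in a..b, 1 / ((ξ : ℂ) - z) ^ 2 = 1 / (a - z) - 1 / (b - z) := by
  have hcont : Continuous fun ξ : ℝ => 1 / ((ξ : ℂ) - z) ^ 2 :=
    Continuous.div continuous_const (by fun_prop) fun ξ => pow_ne_zero _ (ofReal_sub_ne_zero hz ξ)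
  rw [intervalIntegral.integral_eq_sub_of_hasDerivAt (f := fun ξ : ℝ => -((ξ : ℂ) - z)⁻¹)
    (fun ξ _ => ?_) (hcont.intervalIntegrable a b)]
  · simp only [one_div]
    ring
  · have h1 : HasDerivAt (fun ξ : ℝ => (ξ : ℂ) - z) 1 ξ :=
      (Complex.ofRealCLM.hasDerivAt (x := ξ)).sub_const z
    simpa [neg_div] using (h1.fun_inv (ofReal_sub_ne_zero hz ξ)).fun_neg

/-- Subtracting the value of the density at `Re z` from the density turns the singularity of the
kernel into `|ξ - Re z| ^ α / |ξ - z| ^ 2`; the subtracted term is integrated explicitly. -/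
theorem norm_setIntegral_density_le {f : ℝ → ℝ} {a b ρ B : ℝ} {α C : ℝ≥0} {z : ℂ}
    (hα₀ : 0 < α) (hα₁ : α < 1) (hf : HolderOnWith C α f (Icc a b)) (hρ : 0 < ρ)
    (ha : ρ ≤ z.re - a) (hb : ρ ≤ b - z.re) (hz : 0 < z.im) (hB : |f z.re| ≤ B) :
    ‖∫ ξ in Icc a b, f ξ • (1 / ((ξ : ℂ) - z) ^ 2)‖ ≤
      C * (∫ t : ℝ, |t| ^ (α : ℝ) / (1 + t ^ 2)) * z.im ^ ((α : ℝ) - 1) + B * (2 / ρ) := by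
  have hα₀' : (0 : ℝ) < α := by exact_mod_cast hα₀
  have hα₁' : (α : ℝ) < 1 := by exact_mod_cast hα₁
  have hmem : z.re ∈ Icc a b := ⟨by linarith, by linarith⟩
  have hcont : Continuous fun ξ : ℝ => 1 / ((ξ : ℂ) - z) ^ 2 :=
    Continuous.div continuous_const (by fun_prop) fun ξ => pow_ne_zero _ (ofReal_sub_ne_zero hz ξ)
  have hfc : ContinuousOn f (Icc a b) := hf.continuousOn hα₀
  have hi1 : IntegrableOn (fun ξ : ℝ => (f ξ - f z.re) • (1 / ((ξ : ℂ) - z) ^ 2)) (Icc a b) :=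
    ((hfc.sub continuousOn_const).smul hcont.continuousOn).integrableOn_Icc
  have hi2 : IntegrableOn (fun ξ : ℝ => f z.re • (1 / ((ξ : ℂ) - z) ^ 2)) (Icc a b) :=
    (hcont.const_smul (f z.re)).continuousOn.integrableOn_Icc
  have e : ∫ ξ in Icc a b, f ξ • (1 / ((ξ : ℂ) - z) ^ 2) =
      (∫ ξ in Icc a b, (f ξ - f z.re) • (1 / ((ξ : ℂ) - z) ^ 2)) +
        f z.re • (1 / (a - z) - 1 / (b - z)) := by
    rw [← integral_one_div_sub_sq hz, intervalIntegral.integral_of_le (by linarith),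
      ← integral_Icc_eq_integral_Ioc, ← integral_smul, ← integral_add hi1 hi2]
    refine integral_congr_ae (Eventually.of_forall fun ξ => ?_)
    simp only [← add_smul, sub_add_cancel]
  rw [e]
  refine (norm_add_le _ _).trans (add_le_add ?_ ?_)
  · obtain ⟨hI, hIe⟩ := integral_abs_rpow_div_sq_add_sq (x := z.re) hα₀' hα₁' hz
    calc ‖∫ ξ in Icc a b, (f ξ - f z.re) • (1 / ((ξ : ℂ) - z) ^ 2)‖
        ≤ ∫ ξ in Icc a b, C * (|ξ - z.re| ^ (α : ℝ) / ((ξ - z.re) ^ 2 + z.im ^ 2)) := by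
          refine norm_integral_le_of_norm_le (hI.const_mul _).integrableOn ?_
          filter_upwards [ae_restrict_mem measurableSet_Icc] with ξ hξ
          rw [norm_smul, norm_one_div_ofReal_sub_sq, mul_one_div, ← mul_div_assoc]
          gcongr
          exact hf.dist_le hξ hmem
      _ ≤ ∫ ξ, C * (|ξ - z.re| ^ (α : ℝ) / ((ξ - z.re) ^ 2 + z.im ^ 2)) :=
          setIntegral_le_integral (hI.const_mul _) (Eventually.of_forall fun ξ => by
            simp only [Pi.zero_apply]; positivity)
      _ = _ := by rw [integral_const_mul, hIe]; ring
  · rw [norm_smul, Real.norm_eq_abs]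
    have hB0 := (abs_nonneg _).trans hB
    gcongr
    have h1 : ∀ u : ℝ, ρ ≤ |u - z.re| → ‖1 / ((u : ℂ) - z)‖ ≤ 1 / ρ := fun u hu => by
      rw [norm_div, norm_one]
      exact one_div_le_one_div_of_le hρ (hu.trans (abs_sub_re_le_norm_ofReal_sub z u))
    have h2 := h1 a (by rw [abs_sub_comm]; exact ha.trans (le_abs_self _))
    have h3 := h1 b (hb.trans (le_abs_self _))
    calc _ ≤ 1 / ρ + 1 / ρ := (norm_sub_le _ _).trans (add_le_add h2 h3)
      _ = 2 / ρ := by ring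

theorem exists_Icc_subset_of_mem_interior {O : Set ℝ} {x : ℝ} (hx : x ∈ interior O) :
    ∃ r : ℝ, 0 < r ∧ r ≤ 1 / 4 ∧ Icc (x - 2 * r) (x + 2 * r) ⊆ interior O := by
  obtain ⟨ε, hε, h⟩ := Metric.isOpen_iff.1 isOpen_interior x hx
  refine ⟨min (ε / 4) (1 / 4), by positivity, min_le_right _ _, fun y hy => h ?_⟩
  have := min_le_left (ε / 4) (1 / 4)
  rw [Metric.mem_ball, Real.dist_eq, abs_lt]
  constructor <;> linarith [hy.1, hy.2]

/-- The derivative of a Herglotz function grows at most like `(Im z) ^ (α - 1)` near a point around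
which the measure has an `α`-Hölder continuous density. The height `4 * r` leaves room for the path
in `norm_sub_le_of_deriv_growth`. -/
theorem IsHerglotzWith.exists_norm_deriv_le {h : ℂ → ℂ} {b₁ c : ℝ} (hh : IsHerglotzWith h b₁ c β)
    {O : Set ℝ} {α C : ℝ≥0} (hα₀ : 0 < α) (hα₁ : α < 1) {f : ℝ → ℝ}
    (hd : HasDensityOn β f (closure O)) (hf : HolderOnWith C α f (closure O))
    {x₀ : ℝ} (hx₀ : x₀ ∈ interior O) :
    ∃ r > 0, ∃ M, 0 ≤ M ∧ ∀ z : ℂ, |z.re - x₀| < r → 0 < z.im → z.im < 4 * r →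
      ‖deriv h z‖ ≤ M * z.im ^ ((α : ℝ) - 1) := by
  have hα₁' : (α : ℝ) < 1 := by exact_mod_cast hα₁
  obtain ⟨r, hr, hr1, hsub⟩ := exists_Icc_subset_of_mem_interior hx₀
  set A := Icc (x₀ - 2 * r) (x₀ + 2 * r) with hA
  have hAc : A ⊆ closure O := (hsub.trans interior_subset).trans subset_closure
  have hfA := hf.mono hAc
  obtain ⟨B, hB⟩ := isCompact_Icc.exists_bound_of_continuousOn (hfA.continuousOn hα₀)
  set D : ℝ := 2 + (1 + 2 * (|x₀| + 2) ^ 2) / r ^ 2 with hD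
  set J : ℝ := ∫ t : ℝ, |t| ^ (α : ℝ) / (1 + t ^ 2) with hJ
  set L : ℝ := ∫ ξ : ℝ, 1 / (1 + ξ ^ 2) ∂β with hL
  have hJ0 : 0 ≤ J := integral_nonneg fun t => by positivity
  have hL0 : 0 ≤ L := integral_nonneg fun t => by positivity
  have hB0 : 0 ≤ B := (norm_nonneg _).trans (hB x₀ ⟨by linarith, by linarith⟩)
  have hb0 := hh.b₁_nonneg
  refine ⟨r, hr, b₁ + D * L + C * J + B * (2 / r), by positivity, fun z hz1 hz2 hz3 => ?_⟩
  rw [abs_lt] at hz1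
  have hfar : ‖∫ ξ in Aᶜ, 1 / ((ξ : ℂ) - z) ^ 2 ∂β‖ ≤ D * L := by
    calc ‖∫ ξ in Aᶜ, 1 / ((ξ : ℂ) - z) ^ 2 ∂β‖ ≤ ∫ ξ in Aᶜ, D * (1 / (1 + ξ ^ 2)) ∂β := by
          refine norm_integral_le_of_norm_le (hh.integrable.const_mul _).integrableOn ?_
          filter_upwards [ae_restrict_mem measurableSet_Icc.compl] with ξ hξ
          refine norm_one_div_sub_sq_le hr (le_trans ?_ (abs_sub_re_le_norm_ofReal_sub z ξ)) ?_
          · by_contra! hlt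
            rw [abs_lt] at hlt
            exact hξ ⟨by linarith, by linarith⟩
          · refine (Complex.norm_le_abs_re_add_abs_im z).trans ?_
            have h1 : |z.re| ≤ |x₀| + 1 := by
              have h2 := abs_add_le (z.re - x₀) x₀
              have h3 : |z.re - x₀| ≤ 1 := abs_le.2 ⟨by linarith, by linarith⟩
              rw [sub_add_cancel] at h2
              linarith
            rw [abs_of_pos hz2]
            linarith
      _ ≤ ∫ ξ, D * (1 / (1 + ξ ^ 2)) ∂β :=
          setIntegral_le_integral (hh.integrable.const_mul _) (Eventually.of_forall fun ξ => by
            simp only [Pi.zero_apply]; positivity)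
      _ = D * L := integral_const_mul _ _
  have hnear : ‖∫ ξ in A, 1 / ((ξ : ℂ) - z) ^ 2 ∂β‖ ≤
      C * J * z.im ^ ((α : ℝ) - 1) + B * (2 / r) := by
    rw [hd.setIntegral_eq (hf.continuousOn hα₀) hAc measurableSet_Icc]
    exact norm_setIntegral_density_le hα₀ hα₁ hfA hr (by linarith) (by linarith) hz2
      (hB _ ⟨by linarith, by linarith⟩)
  -- As `4 * r ≤ 1`, bounded terms are absorbed by the growing power.
  have h1 : 1 ≤ z.im ^ ((α : ℝ) - 1) :=
    Real.one_le_rpow_of_pos_of_le_one_of_nonpos hz2 (by linarith) (by linarith)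
  rw [(hh.hasDerivAt hz2).deriv, ← integral_add_compl (measurableSet_Icc : MeasurableSet A)
    (hasDerivAt_integral_herglotzKernel hh.integrable hz2).1]
  have hb : ‖(b₁ : ℂ)‖ = b₁ := by rw [Complex.norm_real, Real.norm_of_nonneg hb0]
  calc _ ≤ b₁ + ((C * J * z.im ^ ((α : ℝ) - 1) + B * (2 / r)) + D * L) :=
        (norm_add_le _ _).trans (add_le_add hb.le ((norm_add_le _ _).trans (add_le_add hnear hfar)))
    _ = C * J * z.im ^ ((α : ℝ) - 1) + (b₁ + D * L + B * (2 / r)) * 1 := by ring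
    _ ≤ C * J * z.im ^ ((α : ℝ) - 1) + (b₁ + D * L + B * (2 / r)) * z.im ^ ((α : ℝ) - 1) := by
        gcongr
    _ = _ := by ring

/-! ### Boundary values and principal values -/

theorem integrableOn_abs_sub_rpow {s : ℝ} (hs : -1 < s) (x r : ℝ) (hr : 0 ≤ r) :
    IntegrableOn (fun ξ : ℝ => |ξ - x| ^ s) (Icc (x - r) (x + r)) := by
  have h0 : IntervalIntegrable (fun t : ℝ => |t| ^ s) volume 0 r := by
    refine (intervalIntegral.intervalIntegrable_rpow' (a := 0) (b := r) hs).congr fun t ht => ?_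
    rw [uIoc_of_le hr] at ht
    simp only [abs_of_pos ht.1]
  have h1 : IntervalIntegrable (fun ξ : ℝ => |ξ - x| ^ s) volume x (x + r) := by
    have := h0.comp_sub_right x
    simpa [add_comm] using this
  have h2 : IntervalIntegrable (fun ξ : ℝ => |ξ - x| ^ s) volume x (x - r) := by
    have := h0.comp_sub_left x
    simpa [abs_sub_comm] using this
  rw [integrableOn_Icc_iff_integrableOn_Ioc, ← intervalIntegrable_iff_integrableOn_Ioc_of_le
    (by linarith)]
  exact h2.symm.trans h1

/-- The principal value of `1 / (ξ - x)` over an interval centred at `x` vanishes, by oddness. -/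
theorem setIntegral_inv_sub_eq_zero (x r ε : ℝ) :
    ∫ ξ in Icc (x - r) (x + r) ∩ {ξ | ε < |ξ - x|}, 1 / (ξ - x) = 0 := by
  have hms : MeasurableSet (Icc (x - r) (x + r) ∩ {ξ | ε < |ξ - x|}) :=
    measurableSet_Icc.inter (measurableSet_lt measurable_const (by fun_prop))
  rw [← integral_indicator hms]
  set u := (Icc (x - r) (x + r) ∩ {ξ | ε < |ξ - x|}).indicator fun ξ : ℝ => 1 / (ξ - x) with hu
  have hodd : ∀ ξ, u (2 * x - ξ) = -u ξ := by
    intro ξ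
    have hiff : 2 * x - ξ ∈ Icc (x - r) (x + r) ∩ {ξ | ε < |ξ - x|} ↔
        ξ ∈ Icc (x - r) (x + r) ∩ {ξ | ε < |ξ - x|} := by
      have e : |2 * x - ξ - x| = |ξ - x| := by rw [abs_sub_comm ξ x]; congr 1; ring
      simp only [mem_inter_iff, mem_Icc, mem_ofPred_eq, e]
      refine and_congr_left fun _ => ?_
      constructor <;> rintro ⟨h1, h2⟩ <;> constructor <;> linarith
    by_cases hξ : ξ ∈ Icc (x - r) (x + r) ∩ {ξ | ε < |ξ - x|}
    · rw [hu, indicator_of_mem (hiff.2 hξ), indicator_of_mem hξ, ← one_div_neg_eq_neg_one_div]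
      congr 1
      ring
    · rw [hu, indicator_of_notMem (fun h => hξ (hiff.1 h)), indicator_of_notMem hξ, neg_zero]
  have h1 := integral_sub_left_eq_self u volume (2 * x)
  simp only [hodd, integral_neg] at h1
  linarith

/-- The Cauchy transform of an interval, evaluated along a vertical line through its midpoint: the
two ends contribute equal moduli, and arguments differing by `π`. -/
theorem tendsto_setIntegral_one_div_sub (x : ℝ) {r : ℝ} (hr : 0 < r) :
    Tendsto (fun y : ℝ => ∫ ξ in Icc (x - r) (x + r), 1 / ((ξ : ℂ) - (x + y * Complex.I)))
      (𝓝[>] 0) (𝓝 (Complex.I * Real.pi)) := by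
  have him : ∀ (ξ y : ℝ), ((ξ : ℂ) - (x + y * Complex.I)).im = -y := fun ξ y => by simp
  have e : ∀ y : ℝ, 0 < y → ∫ ξ in Icc (x - r) (x + r), 1 / ((ξ : ℂ) - (x + y * Complex.I)) =
      Complex.log (r - y * Complex.I) - Complex.log (-r - y * Complex.I) := by
    intro y hy
    have hne : ∀ ξ : ℝ, (ξ : ℂ) - (x + y * Complex.I) ≠ 0 := ofReal_sub_ne_zero (by simpa using hy)
    have hcont : Continuous fun ξ : ℝ => 1 / ((ξ : ℂ) - (x + y * Complex.I)) :=
      Continuous.div continuous_const (by fun_prop) hne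
    rw [integral_Icc_eq_integral_Ioc, ← intervalIntegral.integral_of_le (by linarith),
      intervalIntegral.integral_eq_sub_of_hasDerivAt
        (f := fun ξ : ℝ => Complex.log ((ξ : ℂ) - (x + y * Complex.I)))
        (fun ξ _ => ?_) (hcont.intervalIntegrable _ _)]
    · congr 2 <;> push_cast <;> ring
    · have h1 : HasDerivAt (fun ξ : ℝ => (ξ : ℂ) - (x + y * Complex.I)) 1 ξ :=
        (Complex.ofRealCLM.hasDerivAt (x := ξ)).sub_const _
      refine h1.clog_real ?_
      rw [Complex.mem_slitPlane_iff, him]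
      exact Or.inr (by linarith)
  have hlim : ∀ s : ℝ, Tendsto (fun y : ℝ => (s : ℂ) - y * Complex.I) (𝓝[>] 0) (𝓝 (s : ℂ)) := by
    intro s
    have : Continuous fun y : ℝ => (s : ℂ) - y * Complex.I := by fun_prop
    simpa using (this.tendsto 0).mono_left nhdsWithin_le_nhds
  have h1 : Tendsto (fun y : ℝ => Complex.log (r - y * Complex.I)) (𝓝[>] 0)
      (𝓝 (Real.log r : ℂ)) := by
    rw [Complex.ofReal_log hr.le]
    exact (continuousAt_clog (Complex.ofReal_mem_slitPlane.2 hr)).tendsto.comp (hlim r)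
  have h2 : Tendsto (fun y : ℝ => Complex.log (-r - y * Complex.I)) (𝓝[>] 0)
      (𝓝 (Real.log r - Real.pi * Complex.I)) := by
    have h3 := Complex.tendsto_log_nhdsWithin_im_neg_of_re_neg_of_im_zero (z := ((-r : ℝ) : ℂ))
      (by simpa using hr) (Complex.ofReal_im _)
    rw [Complex.norm_real, norm_neg, Real.norm_of_nonneg hr.le] at h3
    have h4 : Tendsto (fun y : ℝ => ((-r : ℝ) : ℂ) - y * Complex.I) (𝓝[>] 0)
        (𝓝[{z : ℂ | z.im < 0}] ((-r : ℝ) : ℂ)) := by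
      refine tendsto_nhdsWithin_iff.2 ⟨hlim (-r), ?_⟩
      filter_upwards [self_mem_nhdsWithin] with y hy
      simpa using hy
    simpa [Function.comp_def] using h3.comp h4
  have h5 := h1.sub h2
  rw [sub_sub_cancel, mul_comm] at h5
  refine h5.congr' ?_
  filter_upwards [self_mem_nhdsWithin] with y hy
  exact (e y hy).symm

theorem herglotzKernel_ofReal (x ξ : ℝ) :
    herglotzKernel x ξ = ((1 / (ξ - x) - ξ / (1 + ξ ^ 2) : ℝ) : ℂ) := by
  rw [herglotzKernel]
  push_cast
  rfl

theorem tendsto_vertical (x : ℝ) :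
    Tendsto (fun y : ℝ => (x : ℂ) + y * Complex.I) (𝓝[>] 0) (𝓝 (x : ℂ)) := by
  have : Continuous fun y : ℝ => (x : ℂ) + y * Complex.I := by fun_prop
  simpa using (this.tendsto 0).mono_left nhdsWithin_le_nhds

/-- Away from `x`, the Herglotz integral extends continuously to the boundary point `x`. -/
theorem tendsto_setIntegral_compl_herglotzKernel
    (hβ : Integrable (fun ξ : ℝ => 1 / (1 + ξ ^ 2)) β) (x : ℝ) {r : ℝ} (hr : 0 < r) :
    Tendsto (fun y : ℝ => ∫ ξ in (Icc (x - r) (x + r))ᶜ,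
        herglotzKernel (x + y * Complex.I) ξ ∂β) (𝓝[>] 0)
      (𝓝 (∫ ξ in (Icc (x - r) (x + r))ᶜ, herglotzKernel x ξ ∂β)) := by
  have hfar : ∀ ξ ∈ (Icc (x - r) (x + r))ᶜ, r ≤ |ξ - x| := by
    intro ξ hξ
    by_contra! hlt
    rw [abs_lt] at hlt
    exact hξ ⟨by linarith, by linarith⟩
  refine tendsto_integral_filter_of_dominated_convergence
    (fun ξ => ((|x| + 1) + (1 + (|x| + 1) ^ 2) / r) * (1 / (1 + ξ ^ 2)))
    (Eventually.of_forall fun y => (measurable_herglotzKernel _).aestronglyMeasurable) ?_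
    (hβ.const_mul _).integrableOn ?_
  · filter_upwards [Ioo_mem_nhdsGT one_pos] with y hy
    filter_upwards [ae_restrict_mem measurableSet_Icc.compl] with ξ hξ
    refine norm_herglotzKernel_le hr ?_ ?_
    · simpa using (hfar ξ hξ).trans (by
        simpa using abs_sub_re_le_norm_ofReal_sub (x + y * Complex.I) ξ)
    · refine (Complex.norm_le_abs_re_add_abs_im _).trans ?_
      simp [abs_of_pos hy.1, hy.2.le]
  · filter_upwards [ae_restrict_mem measurableSet_Icc.compl] with ξ hξ
    have hne : (ξ : ℂ) - x ≠ 0 := by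
      have := hr.trans_le (hfar ξ hξ)
      rw [abs_pos] at this
      exact_mod_cast this
    exact (hasDerivAt_herglotzKernel hne).continuousAt.tendsto.comp (tendsto_vertical x)

/-- The density times the Herglotz kernel, after subtraction of the singular term
`f x / (ξ - z)`. -/
noncomputable def regularizedKernel (f : ℝ → ℝ) (x : ℝ) (z : ℂ) (ξ : ℝ) : ℂ :=
  (f ξ - f x) • (1 / ((ξ : ℂ) - z)) - f ξ • ((ξ : ℂ) / (1 + (ξ : ℂ) ^ 2))

theorem smul_herglotzKernel_eq (f : ℝ → ℝ) (x : ℝ) (z : ℂ) (ξ : ℝ) :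
    f ξ • herglotzKernel z ξ = regularizedKernel f x z ξ + f x • (1 / ((ξ : ℂ) - z)) := by
  rw [herglotzKernel, regularizedKernel, smul_sub, sub_smul]
  ring

/-- Along the vertical line through `x` the regularized kernel is dominated, uniformly up to and
including the boundary, by an integrable function of size `|ξ - x| ^ (α - 1)`. -/
theorem exists_bound_regularizedKernel {f : ℝ → ℝ} {x r : ℝ} {α C : ℝ≥0} (hr : 0 ≤ r)
    (hα₀ : 0 < α) (hf : HolderOnWith C α f (Icc (x - r) (x + r))) :
    ∃ g : ℝ → ℝ, IntegrableOn g (Icc (x - r) (x + r)) ∧ ∀ ξ ∈ Icc (x - r) (x + r),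
      ∀ y : ℝ, ‖regularizedKernel f x (x + y * Complex.I) ξ‖ ≤ g ξ := by
  have hα₀' : (0 : ℝ) < α := by exact_mod_cast hα₀
  obtain ⟨B, hB⟩ := isCompact_Icc.exists_bound_of_continuousOn (hf.continuousOn hα₀)
  have hx : x ∈ Icc (x - r) (x + r) := ⟨by linarith, by linarith⟩
  have hB0 : 0 ≤ B := (norm_nonneg _).trans (hB x hx)
  refine ⟨fun ξ => C * |ξ - x| ^ ((α : ℝ) - 1) + B * 1,
    ((integrableOn_abs_sub_rpow (by linarith) x r hr).const_mul _).add
      (integrableOn_const (by simp)), fun ξ hξ y => ?_⟩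
  refine (norm_sub_le _ _).trans (add_le_add ?_ ?_)
  · rcases eq_or_ne ξ x with rfl | hne
    · simp only [sub_self, zero_smul, norm_zero]
      positivity
    have hpos : 0 < |ξ - x| := abs_pos.2 (sub_ne_zero.2 hne)
    have h1 : |ξ - x| ≤ ‖(ξ : ℂ) - (x + y * Complex.I)‖ := by
      simpa using abs_sub_re_le_norm_ofReal_sub (x + y * Complex.I) ξ
    have h2 : ‖f ξ - f x‖ ≤ C * |ξ - x| ^ (α : ℝ) := hf.dist_le hξ hx
    rw [norm_smul, norm_div, norm_one, Real.rpow_sub_one hpos.ne', mul_one_div, ← mul_div_assoc]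
    gcongr
  · rw [norm_smul]
    gcongr
    · exact hB ξ hξ
    · have h3 : (ξ : ℂ) / (1 + (ξ : ℂ) ^ 2) = ((ξ / (1 + ξ ^ 2) : ℝ) : ℂ) := by push_cast; rfl
      rw [h3, Complex.norm_real, Real.norm_eq_abs, abs_div, abs_of_pos (by positivity : 0 < 1 + ξ ^ 2),
        div_le_one (by positivity)]
      nlinarith [sq_abs ξ, sq_nonneg (|ξ| - 1)]

theorem aestronglyMeasurable_regularizedKernel {f : ℝ → ℝ} {a b : ℝ}
    (hf : ContinuousOn f (Icc a b)) (x : ℝ) (z : ℂ) :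
    AEStronglyMeasurable (regularizedKernel f x z) (volume.restrict (Icc a b)) := by
  have h1 := hf.aestronglyMeasurable (μ := volume) measurableSet_Icc
  refine AEStronglyMeasurable.sub (AEStronglyMeasurable.smul (h1.sub aestronglyMeasurable_const) ?_)
    (h1.smul ?_) <;> exact Measurable.aestronglyMeasurable (by fun_prop)

theorem integrableOn_regularizedKernel {f : ℝ → ℝ} {x r : ℝ} {α C : ℝ≥0} (hr : 0 ≤ r)
    (hα₀ : 0 < α) (hf : HolderOnWith C α f (Icc (x - r) (x + r))) (y : ℝ) :
    IntegrableOn (regularizedKernel f x (x + y * Complex.I)) (Icc (x - r) (x + r)) := by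
  obtain ⟨g, hg, hgb⟩ := exists_bound_regularizedKernel hr hα₀ hf
  refine hg.mono' (aestronglyMeasurable_regularizedKernel (hf.continuousOn hα₀) x _) ?_
  filter_upwards [ae_restrict_mem measurableSet_Icc] with ξ hξ using hgb ξ hξ y

theorem ae_ne_restrict (x : ℝ) (s : Set ℝ) : ∀ᵐ ξ ∂volume.restrict s, ξ ≠ x :=
  ae_restrict_of_ae (compl_mem_ae_iff.2 (measure_singleton x))

theorem tendsto_setIntegral_regularizedKernel {f : ℝ → ℝ} {x r : ℝ} {α C : ℝ≥0} (hr : 0 ≤ r)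
    (hα₀ : 0 < α) (hf : HolderOnWith C α f (Icc (x - r) (x + r))) :
    Tendsto (fun y : ℝ => ∫ ξ in Icc (x - r) (x + r), regularizedKernel f x (x + y * Complex.I) ξ)
      (𝓝[>] 0) (𝓝 (∫ ξ in Icc (x - r) (x + r), regularizedKernel f x x ξ)) := by
  obtain ⟨g, hg, hgb⟩ := exists_bound_regularizedKernel hr hα₀ hf
  refine tendsto_integral_filter_of_dominated_convergence g (Eventually.of_forall fun y =>
    aestronglyMeasurable_regularizedKernel (hf.continuousOn hα₀) x _)
    (Eventually.of_forall fun y => ?_) hg ?_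
  · filter_upwards [ae_restrict_mem measurableSet_Icc] with ξ hξ using hgb ξ hξ y
  · filter_upwards [ae_ne_restrict x _] with ξ hξ
    have hne : (ξ : ℂ) - x ≠ 0 := by exact_mod_cast sub_ne_zero.2 hξ
    have h0 : ContinuousAt (fun z : ℂ => 1 / ((ξ : ℂ) - z)) x :=
      ContinuousAt.div continuousAt_const (by fun_prop) hne
    have h1 : ContinuousAt (fun z : ℂ => regularizedKernel f x z ξ) x :=
      (h0.const_smul (f ξ - f x)).sub continuousAt_const
    exact h1.tendsto.comp (tendsto_vertical x)

/-- Symmetric truncations of the regularized integral converge, since it converges absolutely. -/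
theorem tendsto_setIntegral_truncation {E : Type*} [NormedAddCommGroup E] [NormedSpace ℝ E]
    {g : ℝ → E} {A : Set ℝ} (x : ℝ) (hg : IntegrableOn g A) :
    Tendsto (fun ε : ℝ => ∫ ξ in A ∩ {ξ | ε < |ξ - x|}, g ξ) (𝓝[>] 0) (𝓝 (∫ ξ in A, g ξ)) := by
  have hm : ∀ ε : ℝ, MeasurableSet {ξ : ℝ | ε < |ξ - x|} := fun ε =>
    measurableSet_lt measurable_const (by fun_prop)
  simp_rw [fun ε : ℝ => (setIntegral_indicator (μ := volume) (s := A) (f := g) (hm ε)).symm]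
  refine tendsto_integral_filter_of_dominated_convergence (fun ξ => ‖g ξ‖)
    (Eventually.of_forall fun ε => hg.aestronglyMeasurable.indicator (hm ε))
    (Eventually.of_forall fun ε => Eventually.of_forall fun ξ => norm_indicator_le_norm_self _ _)
    hg.norm ?_
  filter_upwards [ae_ne_restrict x _] with ξ hξ
  refine tendsto_const_nhds.congr' ?_
  filter_upwards [Ioo_mem_nhdsGT (abs_pos.2 (sub_ne_zero.2 hξ))] with ε hε
  rw [indicator_of_mem]
  exact hε.2

/-- Plemelj's formula: the principal value exists, and the real and imaginary parts of the boundary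
value come from the regularized integral and from the subtracted term, respectively. -/
theorem IsHerglotzWith.exists_hasCauchyPV {h : ℂ → ℂ} {b₁ c : ℝ} (hh : IsHerglotzWith h b₁ c β)
    {O : Set ℝ} {α C : ℝ≥0} (hα₀ : 0 < α) {f : ℝ → ℝ}
    (hd : HasDensityOn β f (closure O)) (hf : HolderOnWith C α f (closure O))
    {x : ℝ} (hx : x ∈ interior O) :
    ∃ I : ℝ, HasCauchyPV (fun ξ : ℝ => 1 / (ξ - x) - ξ / (1 + ξ ^ 2)) β x I ∧
      Tendsto (fun y : ℝ => h (x + y * Complex.I)) (𝓝[>] 0)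
        (𝓝 (b₁ * x + c + I + Complex.I * Real.pi * f x)) := by
  obtain ⟨r, hr, -, hsub⟩ := exists_Icc_subset_of_mem_interior hx
  set A := Icc (x - r) (x + r) with hA
  have hAc : A ⊆ closure O := (((Icc_subset_Icc (by linarith) (by linarith)).trans hsub).trans
    interior_subset).trans subset_closure
  have hfA := hf.mono hAc
  have hfc := hf.continuousOn hα₀
  have hmA : MeasurableSet A := measurableSet_Icc
  set k : ℝ → ℝ := fun ξ => 1 / (ξ - x) - ξ / (1 + ξ ^ 2) with hk
  have hkC : ∀ ξ, herglotzKernel x ξ = (k ξ : ℂ) := herglotzKernel_ofReal x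
  have hT : ∀ ε : ℝ, MeasurableSet {ξ : ℝ | ε < |ξ - x|} := fun ε =>
    measurableSet_lt measurable_const (by fun_prop)
  have hint : ∀ ε : ℝ, 0 < ε → IntegrableOn k {ξ : ℝ | ε < |ξ - x|} β := by
    intro ε hε
    have h1 : IntegrableOn (herglotzKernel x) {ξ : ℝ | ε < |ξ - x|} β :=
      integrableOn_herglotzKernel hh.integrable hε (hT ε) fun ξ hξ => by
        refine (le_of_lt hξ).trans ?_
        simpa using abs_sub_re_le_norm_ofReal_sub x ξ
    exact h1.re.congr (Eventually.of_forall fun ξ => by simp [hkC])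
  set G : ℝ → ℝ := fun ξ => (f ξ - f x) * (1 / (ξ - x)) - f ξ * (ξ / (1 + ξ ^ 2)) with hG
  have hGC : ∀ ξ, regularizedKernel f x x ξ = (G ξ : ℂ) := fun ξ => by
    simp only [regularizedKernel, hG, Complex.real_smul]
    push_cast
    rfl
  have hGint : IntegrableOn G A := by
    have h1 := integrableOn_regularizedKernel hr.le hα₀ hfA 0
    simp only [Complex.ofReal_zero, zero_mul, add_zero] at h1
    exact h1.re.congr (Eventually.of_forall fun ξ => by simp [hGC])
  refine ⟨(∫ ξ in Aᶜ, k ξ ∂β) + ∫ ξ in A, G ξ, ⟨hint, ?_⟩, ?_⟩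
  · refine ((tendsto_setIntegral_truncation x hGint).const_add (∫ ξ in Aᶜ, k ξ ∂β)).congr' ?_
    filter_upwards [Ioo_mem_nhdsGT hr] with ε hε
    have hsplit : {ξ : ℝ | ε < |ξ - x|} = Aᶜ ∪ (A ∩ {ξ : ℝ | ε < |ξ - x|}) := by
      ext ξ
      by_cases hξ : ξ ∈ A
      · simp [hξ]
      · simp only [mem_union, mem_compl_iff, hξ, not_false_eq_true, true_or, iff_true]
        by_contra hle
        have hlt := (not_lt.1 hle).trans hε.2.le
        rw [abs_le] at hlt
        exact hξ ⟨by linarith, by linarith⟩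
    have hi := hint ε hε.1
    rw [hsplit, integrableOn_union] at hi
    rw [hsplit, setIntegral_union (disjoint_compl_left.mono_right inter_subset_left)
      (hmA.inter (hT ε)) hi.1 hi.2, ← hsplit,
      hd.setIntegral_eq hfc (inter_subset_left.trans hAc) (hmA.inter (hT ε))]
    congr 1
    have hinv : IntegrableOn (fun ξ : ℝ => 1 / (ξ - x)) (A ∩ {ξ : ℝ | ε < |ξ - x|}) := by
      refine Measure.integrableOn_of_bounded (M := 1 / ε)
        (measure_ne_top_of_subset inter_subset_left (by simp [hA]))
        (Measurable.aestronglyMeasurable (by fun_prop)) ?_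
      filter_upwards [ae_restrict_mem (hmA.inter (hT ε))] with ξ hξ
      rw [norm_div, norm_one, Real.norm_eq_abs]
      exact one_div_le_one_div_of_le hε.1 (le_of_lt hξ.2)
    have e : ∀ ξ, f ξ • k ξ = G ξ + f x * (1 / (ξ - x)) := fun ξ => by
      simp only [hk, hG, smul_eq_mul]
      ring
    simp_rw [e]
    rw [integral_add (hGint.mono_set inter_subset_left) (hinv.const_mul _), integral_const_mul,
      setIntegral_inv_sub_eq_zero, mul_zero, add_zero]
  · have h1 := tendsto_setIntegral_compl_herglotzKernel hh.integrable x hr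
    have h2 := tendsto_setIntegral_regularizedKernel hr.le hα₀ hfA
    have h3 := (tendsto_setIntegral_one_div_sub x hr).const_smul (f x)
    have h4 := ((tendsto_vertical x).const_mul (b₁ : ℂ)).add_const (c : ℂ)
    have h5 := h4.add (h1.add (h2.add h3))
    simp_rw [← hA, hkC, hGC, integral_complex_ofReal] at h5
    have e : (b₁ * x + c + (((∫ ξ in Aᶜ, k ξ ∂β) + ∫ ξ in A, G ξ : ℝ) : ℂ) +
        Complex.I * Real.pi * f x : ℂ) = b₁ * x + c + (((∫ ξ in Aᶜ, k ξ ∂β : ℝ) : ℂ) +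
        (((∫ ξ in A, G ξ : ℝ) : ℂ) + f x • (Complex.I * Real.pi))) := by
      rw [Complex.real_smul]
      push_cast
      ring
    rw [e]
    refine h5.congr' ?_
    filter_upwards [self_mem_nhdsWithin] with y hy
    have hz : 0 < ((x : ℂ) + y * Complex.I).im := by simpa using hy
    have hcont : Continuous fun ξ : ℝ => 1 / ((ξ : ℂ) - (x + y * Complex.I)) :=
      Continuous.div continuous_const (by fun_prop) (ofReal_sub_ne_zero hz)
    have hH := hh.eq_integral _ hz
    change _ = _ + ∫ ξ : ℝ, herglotzKernel (x + y * Complex.I) ξ ∂β at hH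
    rw [hH, ← integral_add_compl hmA (integrable_herglotzKernel hh.integrable hz),
      hd.setIntegral_eq hfc hAc hmA]
    simp_rw [smul_herglotzKernel_eq f x]
    have hi : IntegrableOn (fun ξ : ℝ => f x • (1 / ((ξ : ℂ) - (x + y * Complex.I)))) A :=
      (hcont.const_smul (f x)).continuousOn.integrableOn_Icc
    rw [integral_add (integrableOn_regularizedKernel hr.le hα₀ hfA y) hi, integral_smul]
    ring

/-! ### The Hölder continuous extension -/

/-- Analytic functions are locally Lipschitz, and on a set of bounded diameter this implies Hölder
continuity with any smaller exponent. -/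
theorem IsHerglotzWith.exists_holderOnWith_nhds {h : ℂ → ℂ} {b₁ c : ℝ} {β : Measure ℝ}
    (hh : IsHerglotzWith h b₁ c β) {z : ℂ} (hz : 0 < z.im) {α : ℝ≥0} (hα₁ : α < 1) :
    ∃ U ∈ 𝓝 z, U ⊆ {w : ℂ | 0 < w.im} ∧ ∃ C : ℝ≥0, HolderOnWith C α h U := by
  have hopen : IsOpen {w : ℂ | 0 < w.im} := isOpen_lt continuous_const Complex.continuous_im
  have han : AnalyticAt ℂ h z := DifferentiableOn.analyticAt (s := {w : ℂ | 0 < w.im})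
    (fun w hw => (hh.hasDerivAt hw).differentiableAt.differentiableWithinAt) (hopen.mem_nhds hz)
  obtain ⟨K, t, ht, hK⟩ := (han.contDiffAt (n := 1)).exists_lipschitzOnWith
  refine ⟨t ∩ {w : ℂ | 0 < w.im} ∩ Metric.ball z 1,
    inter_mem (inter_mem ht (hopen.mem_nhds hz)) (Metric.ball_mem_nhds z one_pos),
    fun w hw => hw.1.2, ?_⟩
  have hsub : t ∩ {w : ℂ | 0 < w.im} ∩ Metric.ball z 1 ⊆ t := fun w hw => hw.1.1
  have h1 := holderOnWith_one.2 (hK.mono hsub)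
  refine ⟨_, h1.of_le (D := 2) (fun x hx y hy => ?_) hα₁.le⟩
  have h2 := dist_triangle_right x y z
  have h3 : dist x y ≤ 2 := by linarith [Metric.mem_ball.1 hx.2, Metric.mem_ball.1 hy.2]
  rw [edist_dist]
  exact ENNReal.ofReal_le_of_le_toReal (by simpa using h3)

theorem theorem2 (h : ℂ → ℂ) (b₁ c : ℝ) (β : Measure ℝ) (hh : IsHerglotzWith h b₁ c β)
    (Ω O : Set ℝ) (hΩ : IsFiniteUnionIcc Ω) (hO : O ∈ 𝓝ˢ Ω)
    (α : ℝ≥0) (hα₀ : 0 < α) (hα₁ : α < 1)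
    (f : ℝ → ℝ) (hdens : HasDensityOn β f (closure O))
    (hf : ∃ C : ℝ≥0, HolderOnWith C α f (closure O)) :
    ∃ H : ℂ → ℂ,
      (∀ z : ℂ, 0 < z.im → H z = h z) ∧
      (∀ K : Set ℂ, IsCompact K → K ⊆ upperUnion (interior O) →
        ∃ C : ℝ≥0, HolderOnWith C α H (K ∩ upperUnion Ω)) ∧
      (∀ x ∈ Ω, ∃ I : ℝ,
        HasCauchyPV (fun ξ : ℝ => 1 / (ξ - x) - ξ / (1 + ξ ^ 2)) β x I ∧
        H (x : ℂ) = b₁ * x + c + I + Complex.I * Real.pi * f x) := by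
  obtain ⟨C₀, hf⟩ := hf
  have hα₀' : (0 : ℝ) < α := by exact_mod_cast hα₀
  have hα₁' : (α : ℝ) < 1 := by exact_mod_cast hα₁
  have hΩO : Ω ⊆ interior O := subset_interior_iff_mem_nhdsSet.2 hO
  choose! I hI hlim using fun (x : ℝ) (hx : x ∈ interior O) => hh.exists_hasCauchyPV hα₀ hdens hf hx
  set H : ℂ → ℂ := fun z => if 0 < z.im then h z else
    b₁ * z.re + c + I z.re + Complex.I * Real.pi * f z.re with hH
  have hHh : ∀ z : ℂ, 0 < z.im → H z = h z := fun z hz => if_pos hz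
  have hHx : ∀ x : ℝ, H x = b₁ * x + c + I x + Complex.I * Real.pi * f x := fun x => by simp [hH]
  have hvert : ∀ z ∈ upperUnion (interior O),
      Tendsto (fun y : ℝ => h (z + y * Complex.I)) (𝓝[>] 0) (𝓝 (H z)) := by
    rintro z (hz | ⟨x, hx, rfl⟩)
    · rw [hHh z hz]
      have h1 : Continuous fun y : ℝ => z + y * Complex.I := by fun_prop
      have h2 := (h1.tendsto 0).mono_left (nhdsWithin_le_nhds (s := Ioi 0))
      simp only [Complex.ofReal_zero, zero_mul, add_zero] at h2
      exact (hh.hasDerivAt hz).continuousAt.tendsto.comp h2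
    · simp only [hHx]
      exact hlim x hx
  refine ⟨H, hHh, fun K hK hKO => ?_, fun x hx => ⟨I x, hI x (hΩO hx), hHx x⟩⟩
  have hmono : upperUnion Ω ⊆ upperUnion (interior O) :=
    union_subset_union_right _ (image_mono hΩO)
  suffices hS : ∃ C : ℝ≥0, HolderOnWith C α H (K ∩ upperUnion (interior O)) by
    obtain ⟨C, hC⟩ := hS
    exact ⟨C, hC.mono (inter_subset_inter_right _ hmono)⟩
  refine hK.exists_holderOnWith fun z hz => ?_
  rcases hKO hz with hz | ⟨x₀, hx₀, rfl⟩
  · obtain ⟨U, hU, hUim, C, hC⟩ := hh.exists_holderOnWith_nhds hz hα₁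
    refine ⟨U, hU, C, fun u hu v hv => ?_⟩
    rw [hHh u (hUim hu.1), hHh v (hUim hv.1)]
    exact hC.edist_le hu.1 hv.1
  · obtain ⟨r, hr, M, hM, hb⟩ := hh.exists_norm_deriv_le hα₀ hα₁ hdens hf hx₀
    have hUo : IsOpen {z : ℂ | |z.re - x₀| < r ∧ z.im < r} :=
      (isOpen_lt (Complex.continuous_re.sub continuous_const).abs continuous_const).and
        (isOpen_lt Complex.continuous_im continuous_const)
    refine ⟨{z : ℂ | |z.re - x₀| < r ∧ z.im < r}, hUo.mem_nhds (by simpa using hr),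
      (2 * (M / α) + M).toNNReal, holderOnWith_of_dist_le fun z hz w hw => ?_⟩
    rw [dist_eq_norm, dist_eq_norm]
    -- The estimate holds for the translates `z + iy`, `w + iy` in the open half-plane; let `y → 0`.
    refine le_of_tendsto ((hvert z hz.2).sub (hvert w hw.2)).norm ?_
    have him : ∀ u ∈ upperUnion (interior O), 0 ≤ u.im := by
      rintro u (hu | ⟨x, -, rfl⟩)
      · exact le_of_lt hu
      · simp
    have hlt : 0 < min (r - z.im) (r - w.im) :=
      lt_min (by linarith [hz.1.2]) (by linarith [hw.1.2])
    filter_upwards [Ioo_mem_nhdsGT hlt] with y hy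
    have hy1 := hy.1
    have hy2 := lt_min_iff.1 hy.2
    have key := norm_sub_le_of_deriv_growth (z := z + y * Complex.I) (w := w + y * Complex.I)
      hα₀' hα₁' hM (fun u hu => (hh.hasDerivAt hu).differentiableAt) hb
      (by simpa using hz.1.1) (by simpa using hw.1.1)
      (by simp; linarith [him z hz.2]) (by simp; linarith [him w hw.2])
      (by simp; linarith) (by simp; linarith)
    rwa [add_sub_add_right_eq_sub] at key
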